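/- Let $N\in\mathbb{N}$ and let $\mathscr{E}:\mathbb{R}^N\to[0,\infty]$ be convex and lower semicontinuous with dense effective domain. Let $\partial\mathscr{E}$ denote its subdifferential with respect to the Euclidean inner product, and let $(T_t)_{t\ge 0}$ be the semigroup on $\mathbb{R}^N$ generated by $-\partial\mathscr{E}$: for every $u_0\in\mathbb{R}^N$, $u(t)=T_tu_0$ is the unique function that is continuous on $[0,\infty)$, absolutely continuous on compact subintervals of $(0,\infty)$, and satisfies $$0\in \frac{du}{dt}(t)+\partial\mathscr{E}(u(t))\ \text{ for almost every } t\ge 0,\qquad u(0)=u_0 .$$ Assume that $\mathscr{E}$ is a nonlinear Dirichlet form, i.e. that $T$ is sub-Markovian: for all $u,v\in\mathbb{R}^N$ and $t\ge0$, $u\le v$ (coordinatewise) implies $T_tu\le T_tv$, and $\|T_tu-T_tv\|_\infty\le\|u-v\|_\infty$. Assume moreover that $$\mathscr{E}(\lambda u)=\lambda^2\mathscr{E}(u),\qquad \mathscr{E}(u+a\cdot(1,\dots,1))=\mathscr{E}(u)\qquad\text{for all } u\in\mathbb{R}^N,\ \lambda,a\in\mathbb{R},$$ and that the generator $-\partial\mathscr{E}$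 is bounded, i.e. for every $r$ there is a $C$ such that $\|w\|\le C$ whenever $\|u\|\le r$ and $w\in-\partial\mathscr{E}(u)$. Let $t\ge0$, $f\in\mathbb{R}^N$ and $x_0\in\{1,\dots,N\}$, and put $f_n:=T_t^nf-(T_t^nf)(x_0)\cdot(1,\dots,1)$, where $T_t^n$ is the $n$-th iterate of $T_t$. Suppose that the sequence $(f_n)$ has an accumulation point $g\in\mathbb{R}^N$, i.e. for every $n$ and every $\varepsilon>0$ there is $m>n$ with $\|f_m-g\|_\infty<\varepsilon$. Then $f_n\to g$ as $n\to\infty$, and the sequence $T_t^nf$ itself converges in $\mathbb{R}^N$. -/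

import Mathlib

open Filter Topology MeasureTheory
open scoped NNReal ENNReal

namespace NonlinearDirichlet

/-- The constant function with value `c` in `ℝ^N`. -/
def constVec {N : ℕ} (c : ℝ) : EuclideanSpace ℝ (Fin N) :=
  WithLp.toLp 2 (fun _ => c)

/-- The supremum norm on `ℝ^N` (the norm of `EuclideanSpace` is the `ℓ²` norm). -/
noncomputable def supNorm {N : ℕ} (u : EuclideanSpace ℝ (Fin N)) : ℝ :=
  ‖(WithLp.ofLp u : Fin N → ℝ)‖

/-- The subdifferential `∂E(u)` with respect to the Euclidean inner product: it is empty where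
`E u = ∞`, and otherwise it consists of all `w` with `E u + ⟪w, v - u⟫ ≤ E v` for all `v`. -/
def subdifferential {N : ℕ} (E : EuclideanSpace ℝ (Fin N) → ℝ≥0∞)
    (u : EuclideanSpace ℝ (Fin N)) : Set (EuclideanSpace ℝ (Fin N)) :=
  {w | E u ≠ ∞ ∧ ∀ v, E v ≠ ∞ → (E u).toReal + inner ℝ w (v - u) ≤ (E v).toReal}

/-- `u` is the (strong) solution on `[0, ∞)` of the Cauchy problem
`0 ∈ u'(t) + ∂E(u(t))` for almost every `t`, `u(0) = u₀`. -/
structure IsSolution {N : ℕ} (E : EuclideanSpace ℝ (Fin N) → ℝ≥0∞)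
    (u₀ : EuclideanSpace ℝ (Fin N)) (u : ℝ → EuclideanSpace ℝ (Fin N)) : Prop where
  initial : u 0 = u₀
  continuousOn : ContinuousOn u (Set.Ici 0)
  absolutelyContinuous : ∀ a b : ℝ, 0 < a → a ≤ b → AbsolutelyContinuousOnInterval u a b
  inclusion : ∀ᵐ t ∂(volume.restrict (Set.Ioi (0 : ℝ))),
    ∃ w, HasDerivAt u w t ∧ -w ∈ subdifferential E (u t)

open Classical in
/-- The semigroup `T_t u₀ = u(t)` generated by `-∂E`, for `t ≥ 0`, where `u` is the solution of
the Cauchy problem with initial value `u₀`.  The solution is unique on `[0, ∞)` (see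
`IsSolution.eq_of_nonneg` and `semigroup_eq`).  For a convex, lower semicontinuous `E` with dense
effective domain it exists for every `u₀`, and the second branch is never used. -/
noncomputable def semigroup {N : ℕ} (E : EuclideanSpace ℝ (Fin N) → ℝ≥0∞) (t : ℝ)
    (u₀ : EuclideanSpace ℝ (Fin N)) : EuclideanSpace ℝ (Fin N) :=
  if h : ∃ u, IsSolution E u₀ u then h.choose t else u₀

/-- A nonlinear Dirichlet form on `ℝ^N`: a convex, lower semicontinuous functional
`E : ℝ^N → [0, ∞]` with dense effective domain, whose semigroup is sub-Markovian, i.e. order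
preserving and `L^∞`-contractive. -/
structure IsDirichletForm {N : ℕ} (E : EuclideanSpace ℝ (Fin N) → ℝ≥0∞) : Prop where
  convex : ConvexOn ℝ≥0 Set.univ E
  lowerSemicontinuous : LowerSemicontinuous E
  dense_domain : Dense {u | E u ≠ ∞}
  order_preserving : ∀ t : ℝ, 0 ≤ t → ∀ u v : EuclideanSpace ℝ (Fin N),
    (∀ i, u i ≤ v i) → ∀ i, semigroup E t u i ≤ semigroup E t v i
  contractive : ∀ t : ℝ, 0 ≤ t → ∀ u v : EuclideanSpace ℝ (Fin N),
    supNorm (semigroup E t u - semigroup E t v) ≤ supNorm (u - v)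

/-- The (multivalued) generator `-∂E` is bounded: it maps bounded sets to bounded sets. -/
def HasBoundedGenerator {N : ℕ} (E : EuclideanSpace ℝ (Fin N) → ℝ≥0∞) : Prop :=
  ∀ r : ℝ, ∃ C : ℝ, ∀ u, ‖u‖ ≤ r → ∀ w ∈ subdifferential E u, ‖-w‖ ≤ C

/-- The normalized iterates `f_n = P^n f - P^n f(x₀)`. -/
def normalizedIterate {N : ℕ} (P : EuclideanSpace ℝ (Fin N) → EuclideanSpace ℝ (Fin N))
    (f : EuclideanSpace ℝ (Fin N)) (x₀ : Fin N) (n : ℕ) : EuclideanSpace ℝ (Fin N) :=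
  P^[n] f - constVec (P^[n] f x₀)

/-- `g ∈ ℝ^N` is an accumulation point of `f_n = P^n f - P^n f(x₀)`. -/
def IsAccumulationPointAtInfinity {N : ℕ}
    (P : EuclideanSpace ℝ (Fin N) → EuclideanSpace ℝ (Fin N))
    (f : EuclideanSpace ℝ (Fin N)) (x₀ : Fin N) (g : EuclideanSpace ℝ (Fin N)) : Prop :=
  ∀ n : ℕ, ∀ ε : ℝ, 0 < ε → ∃ m : ℕ, n < m ∧ supNorm (normalizedIterate P f x₀ m - g) < ε

/-- The subdifferential is a monotone operator. -/
theorem subdifferential_monotone {N : ℕ} {E : EuclideanSpace ℝ (Fin N) → ℝ≥0∞}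
    {u v w z : EuclideanSpace ℝ (Fin N)} (hw : w ∈ subdifferential E u)
    (hz : z ∈ subdifferential E v) : 0 ≤ inner ℝ (w - z) (u - v) := by
  have h1 := hw.2 v hz.1
  have h2 := hz.2 u hw.1
  have h3 : inner ℝ w (v - u) = -inner ℝ w (u - v) := by
    rw [← inner_neg_right, neg_sub]
  rw [inner_sub_left]
  linarith

/-- Solutions of the Cauchy problem are unique on `[0, ∞)`. -/
theorem IsSolution.eq_of_nonneg {N : ℕ} {E : EuclideanSpace ℝ (Fin N) → ℝ≥0∞}
    {u₀ : EuclideanSpace ℝ (Fin N)} {u v : ℝ → EuclideanSpace ℝ (Fin N)}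
    (hu : IsSolution E u₀ u) (hv : IsSolution E u₀ v) {t : ℝ} (ht : 0 ≤ t) : u t = v t := by
  rcases ht.eq_or_lt with rfl | ht
  · rw [hu.initial, hv.initial]
  set d : ℝ → ℝ := fun s => ‖u s - v s‖ * ‖u s - v s‖ with hd
  have hde : d = fun s => inner ℝ (u s - v s) (u s - v s) := by
    funext s
    rw [hd, real_inner_self_eq_norm_mul_norm]
  have hle : ∀ a, 0 < a → a ≤ t → d t ≤ d a := by
    intro a ha hat
    have hn : AbsolutelyContinuousOnInterval (fun s => ‖u s - v s‖) a t := by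
      have h := (hu.absolutelyContinuous a t ha hat).fun_sub (hv.absolutelyContinuous a t ha hat)
      refine squeeze_zero (fun E => Finset.sum_nonneg fun i _ => dist_nonneg) (fun E => ?_) h
      exact Finset.sum_le_sum fun i _ => dist_norm_norm_le _ _
    have hda : AbsolutelyContinuousOnInterval d a t := hn.fun_mul hn
    have hFTC := hda.integral_deriv_eq_sub
    have h1 := (ae_restrict_iff' measurableSet_Ioi).1 hu.inclusion
    have h2 := (ae_restrict_iff' measurableSet_Ioi).1 hv.inclusion
    have hnon : ∫ s in a..t, -deriv d s ≥ 0 := by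
      rw [intervalIntegral.integral_of_le hat]
      refine integral_nonneg_of_ae ?_
      refine (ae_restrict_iff' measurableSet_Ioc).2 ?_
      filter_upwards [h1, h2] with s hs1 hs2 hs
      have hs0 : s ∈ Set.Ioi (0 : ℝ) := ha.trans hs.1
      obtain ⟨w, hw, hw'⟩ := hs1 hs0
      obtain ⟨z, hz, hz'⟩ := hs2 hs0
      have hD : HasDerivAt d (inner ℝ (u s - v s) (w - z) + inner ℝ (w - z) (u s - v s)) s := by
        rw [hde]
        exact (hw.sub hz).inner ℝ (hw.sub hz)
      have hm := subdifferential_monotone hw' hz'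
      have hneg : -w - -z = -(w - z) := by abel
      rw [hneg, inner_neg_left] at hm
      rw [hD.deriv, real_inner_comm (w - z) (u s - v s)]
      simp only [Pi.zero_apply]
      linarith
    rw [intervalIntegral.integral_neg, hFTC] at hnon
    linarith
  have hcont : ContinuousOn d (Set.Ici 0) :=
    (hu.continuousOn.sub hv.continuousOn).norm.mul (hu.continuousOn.sub hv.continuousOn).norm
  have hlim : Tendsto d (𝓝[>] 0) (𝓝 (d 0)) :=
    (hcont 0 Set.self_mem_Ici).mono_left (nhdsWithin_mono 0 Set.Ioi_subset_Ici_self)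
  have hev : ∀ᶠ a in 𝓝[>] (0 : ℝ), d t ≤ d a := by
    filter_upwards [Ioo_mem_nhdsGT ht] with a ha
    exact hle a ha.1 ha.2.le
  have h0 : d t ≤ d 0 := ge_of_tendsto hlim hev
  have hd0 : d 0 = 0 := by simp [hd, hu.initial, hv.initial]
  have hdt : ‖u t - v t‖ * ‖u t - v t‖ = 0 :=
    le_antisymm (h0.trans hd0.le) (mul_self_nonneg _)
  exact sub_eq_zero.1 (norm_eq_zero.1 (mul_self_eq_zero.1 hdt))

/-- The semigroup is given by any solution of the Cauchy problem. -/
theorem semigroup_eq {N : ℕ} {E : EuclideanSpace ℝ (Fin N) → ℝ≥0∞}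
    {u₀ : EuclideanSpace ℝ (Fin N)} {u : ℝ → EuclideanSpace ℝ (Fin N)}
    (hu : IsSolution E u₀ u) {t : ℝ} (ht : 0 ≤ t) : semigroup E t u₀ = u t := by
  have h : ∃ u, IsSolution E u₀ u := ⟨u, hu⟩
  rw [semigroup, dif_pos h]
  exact h.choose_spec.eq_of_nonneg hu ht

end NonlinearDirichlet

/-!
The functional `E` is nonnegative and `E 0 = 0` by homogeneity, so `0` is a minimizer and the
semigroup is the gradient flow of a convex function that attains its minimum on a
finite-dimensional space. Such a flow converges.

Solutions are obtained from the implicit Euler scheme, whose steps minimize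
`v ↦ E v + ‖v - x‖² / (2h)`. The scheme stays in a ball, where the bounded generator makes it
Lipschitz with a constant independent of the step, and it satisfies a discrete evolution variational
inequality. Its limit as the step tends to zero is Lipschitz and inherits from lower semicontinuity
the inequality `d/dt ‖u - v‖² / 2 ≤ E v - E u`; at a point of differentiability this says exactly
that `-u' ∈ ∂E(u)` (`exists_limit_implicitEuler`, `exists_isSolution`). The inequality also shows
that `T_t` does not increase the distance to a zero of `E`, and that for `t > 0` it strictly
decreases the norm of every point at which `E` does not vanish.

The second property, with the continuity of `T_t`, forces every cluster point of the bounded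
sequence `T_t^n f` to be a zero of `E`; by the first property the distance of `T_t^n f` to such a
cluster point decreases, hence tends to zero (`exists_tendsto_iterate_of_fejer`). Therefore `T_t^n f`
converges, so does `f_n`, and the limit of `f_n` is its only accumulation point.
-/

namespace NonlinearDirichlet

/-! ### The implicit Euler scheme -/

/-- The sequence `x` is produced by the implicit Euler scheme with step `h` for `0 ∈ u' + ∂E(u)`:
`(x (n + 1) - x n) / h ∈ -∂E(x (n + 1))` for all `n`. -/
def IsImplicitEuler {N : ℕ} (E : EuclideanSpace ℝ (Fin N) → ℝ≥0∞) (h : ℝ)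
    (x : ℕ → EuclideanSpace ℝ (Fin N)) : Prop :=
  ∀ n, h⁻¹ • (x n - x (n + 1)) ∈ subdifferential E (x (n + 1))

theorem convex_toReal {N : ℕ} {E : EuclideanSpace ℝ (Fin N) → ℝ≥0∞}
    (hc : ConvexOn ℝ≥0 Set.univ E) {y v : EuclideanSpace ℝ (Fin N)} (hy : E y ≠ ∞)
    (hv : E v ≠ ∞) {s : ℝ} (hs0 : 0 ≤ s) (hs1 : s ≤ 1) :
    E (y + s • (v - y)) ≠ ∞ ∧
      (E (y + s • (v - y))).toReal ≤ (1 - s) * (E y).toReal + s * (E v).toReal := by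
  have h1 : 0 ≤ 1 - s := sub_nonneg.2 hs1
  have hsum : Real.toNNReal (1 - s) + Real.toNNReal s = 1 := by
    rw [← Real.toNNReal_add h1 hs0]; simp
  have h := hc.2 (Set.mem_univ y) (Set.mem_univ v) (zero_le (a := Real.toNNReal (1 - s)))
    (zero_le (a := Real.toNNReal s)) hsum
  have hpt : Real.toNNReal (1 - s) • y + Real.toNNReal s • v = y + s • (v - y) := by
    rw [NNReal.smul_def, NNReal.smul_def, Real.coe_toNNReal _ h1, Real.coe_toNNReal _ hs0,
      sub_smul, smul_sub, one_smul]
    abel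
  rw [hpt, ENNReal.smul_def, ENNReal.smul_def, smul_eq_mul, smul_eq_mul] at h
  have f1 : ((1 - s).toNNReal : ℝ≥0∞) * E y ≠ ∞ := ENNReal.mul_ne_top ENNReal.coe_ne_top hy
  have f2 : (s.toNNReal : ℝ≥0∞) * E v ≠ ∞ := ENNReal.mul_ne_top ENNReal.coe_ne_top hv
  refine ⟨ne_top_of_le_ne_top (ENNReal.add_ne_top.2 ⟨f1, f2⟩) h, ?_⟩
  have h' := ENNReal.toReal_mono (ENNReal.add_ne_top.2 ⟨f1, f2⟩) h
  rwa [ENNReal.toReal_add f1 f2, ENNReal.toReal_mul, ENNReal.toReal_mul, ENNReal.coe_toReal,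
    ENNReal.coe_toReal, Real.coe_toNNReal _ h1, Real.coe_toNNReal _ hs0] at h'

/-- The resolvent `(1 + h ∂E)⁻¹` is everywhere defined: its value at `x` is the minimizer of
`v ↦ E v + ‖v - x‖² / (2h)`. -/
theorem exists_resolvent {N : ℕ} {E : EuclideanSpace ℝ (Fin N) → ℝ≥0∞}
    (hc : ConvexOn ℝ≥0 Set.univ E) (hl : LowerSemicontinuous E) (h0 : E 0 = 0) {h : ℝ}
    (hh : 0 < h) (x : EuclideanSpace ℝ (Fin N)) :
    ∃ y, h⁻¹ • (x - y) ∈ subdifferential E y := by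
  set q : EuclideanSpace ℝ (Fin N) → ℝ := fun v => ‖v - x‖ ^ 2 / (2 * h) with hq
  have hq0 : ∀ v, 0 ≤ q v := fun v => by positivity
  have hqc : Continuous q := by fun_prop
  have hφ : LowerSemicontinuous fun v => E v + ENNReal.ofReal (q v) :=
    hl.add (ENNReal.continuous_ofReal.comp hqc).lowerSemicontinuous
  have hmem : (0 : EuclideanSpace ℝ (Fin N)) ∈ Metric.closedBall x ‖x‖ := by simp
  obtain ⟨y, -, hy⟩ := (hφ.lowerSemicontinuousOn _).exists_isMinOn ⟨0, hmem⟩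
    (isCompact_closedBall x ‖x‖)
  have hy0 : E y + ENNReal.ofReal (q y) ≤ ENNReal.ofReal (q 0) := by
    simpa [h0] using hy hmem
  have hmin : ∀ v, E y + ENNReal.ofReal (q y) ≤ E v + ENNReal.ofReal (q v) := by
    intro v
    by_cases hv : v ∈ Metric.closedBall x ‖x‖
    · exact hy hv
    · refine hy0.trans (le_trans (ENNReal.ofReal_le_ofReal ?_) le_add_self)
      rw [Metric.mem_closedBall, not_le, dist_eq_norm] at hv
      simp only [hq, zero_sub, norm_neg]
      gcongr
  have hyt : E y ≠ ∞ := by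
    refine ne_top_of_le_ne_top ENNReal.ofReal_ne_top (le_trans le_self_add hy0)
  have hminR : ∀ v, E v ≠ ∞ → (E y).toReal + q y ≤ (E v).toReal + q v := by
    intro v hv
    have := ENNReal.toReal_mono (ENNReal.add_ne_top.2 ⟨hv, ENNReal.ofReal_ne_top⟩) (hmin v)
    rwa [ENNReal.toReal_add hyt ENNReal.ofReal_ne_top, ENNReal.toReal_add hv ENNReal.ofReal_ne_top,
      ENNReal.toReal_ofReal (hq0 _), ENNReal.toReal_ofReal (hq0 _)] at this
  refine ⟨y, hyt, fun v hv => ?_⟩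
  -- Compare `y` with the points of the segment from `y` to `v` and let them tend to `y`.
  have key : ∀ s ∈ Set.Ioo (0 : ℝ) 1, (E y).toReal + inner ℝ (h⁻¹ • (x - y)) (v - y) ≤
      (E v).toReal + s * (‖v - y‖ ^ 2 / (2 * h)) := by
    intro s hs
    obtain ⟨hfin, hle⟩ := convex_toReal hc hyt hv hs.1.le hs.2.le
    have h1 := hminR _ hfin
    have h2 : q (y + s • (v - y)) =
        q y - s * inner ℝ (h⁻¹ • (x - y)) (v - y) + s * (s * (‖v - y‖ ^ 2 / (2 * h))) := by
      have h3 : y + s • (v - y) - x = s • (v - y) - (x - y) := by abel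
      simp only [hq]
      rw [h3, norm_sub_sq_real, norm_smul, mul_pow, Real.norm_eq_abs, sq_abs, inner_smul_left,
        inner_smul_left, real_inner_comm (x - y) (v - y), norm_sub_rev y x]
      simp only [conj_trivial]
      field_simp
      ring
    rw [h2] at h1
    have h4 : s * ((E y).toReal + inner ℝ (h⁻¹ • (x - y)) (v - y)) ≤
        s * ((E v).toReal + s * (‖v - y‖ ^ 2 / (2 * h))) := by linarith
    exact le_of_mul_le_mul_left h4 hs.1
  have hlim : Tendsto (fun s : ℝ => (E v).toReal + s * (‖v - y‖ ^ 2 / (2 * h))) (𝓝[>] 0)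
      (𝓝 ((E v).toReal + 0 * (‖v - y‖ ^ 2 / (2 * h)))) :=
    ((by fun_prop : Continuous fun s : ℝ => (E v).toReal + s * (‖v - y‖ ^ 2 / (2 * h))).tendsto
      0).mono_left nhdsWithin_le_nhds
  rw [zero_mul, add_zero] at hlim
  refine ge_of_tendsto hlim ?_
  filter_upwards [Ioo_mem_nhdsGT one_pos] with s hs using key s hs

theorem exists_isImplicitEuler {N : ℕ} {E : EuclideanSpace ℝ (Fin N) → ℝ≥0∞}
    (hc : ConvexOn ℝ≥0 Set.univ E) (hl : LowerSemicontinuous E) (h0 : E 0 = 0) {h : ℝ}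
    (hh : 0 < h) (u₀ : EuclideanSpace ℝ (Fin N)) :
    ∃ x : ℕ → EuclideanSpace ℝ (Fin N), x 0 = u₀ ∧ IsImplicitEuler E h x := by
  choose J hJ using exists_resolvent hc hl h0 hh
  refine ⟨fun n => J^[n] u₀, rfl, fun n => ?_⟩
  simp only [Function.iterate_succ_apply']
  exact hJ _

/-- The discrete evolution variational inequality. -/
theorem IsImplicitEuler.sq_norm_step_le {N : ℕ} {E : EuclideanSpace ℝ (Fin N) → ℝ≥0∞} {h : ℝ}
    (hh : 0 < h) {x : ℕ → EuclideanSpace ℝ (Fin N)} (hx : IsImplicitEuler E h x) (n : ℕ)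
    {v : EuclideanSpace ℝ (Fin N)} (hv : E v ≠ ∞) :
    ‖x (n + 1) - v‖ ^ 2 ≤ ‖x n - v‖ ^ 2 + 2 * h * ((E v).toReal - (E (x (n + 1))).toReal) := by
  have h1 := (hx n).2 v hv
  set w := h⁻¹ • (x n - x (n + 1)) with hw
  have h2 : x n - v = (x (n + 1) - v) + h • w := by
    rw [hw, smul_inv_smul₀ hh.ne']; abel
  have h3 : inner ℝ (x (n + 1) - v) (h • w) = - (h * inner ℝ w (v - x (n + 1))) := by
    rw [inner_smul_right, real_inner_comm, ← neg_sub v, inner_neg_right]; ring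
  rw [h2, norm_add_sq_real, h3]
  nlinarith [sq_nonneg ‖h • w‖, mul_le_mul_of_nonneg_left h1 hh.le]

theorem IsImplicitEuler.sq_norm_le {N : ℕ} {E : EuclideanSpace ℝ (Fin N) → ℝ≥0∞} {h : ℝ}
    (hh : 0 < h) {x : ℕ → EuclideanSpace ℝ (Fin N)} (hx : IsImplicitEuler E h x)
    {v : EuclideanSpace ℝ (Fin N)} (hv : E v ≠ ∞) {c : ℝ} {k n : ℕ} (hkn : k ≤ n)
    (hcE : ∀ j, k < j → j ≤ n → c ≤ (E (x j)).toReal) :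
    ‖x n - v‖ ^ 2 ≤ ‖x k - v‖ ^ 2 + 2 * (h * n - h * k) * ((E v).toReal - c) := by
  induction n, hkn using Nat.le_induction with
  | base => simp
  | succ n hn ih =>
    have h1 := ih fun j hj hjn => hcE j hj (hjn.trans n.le_succ)
    have h2 := hx.sq_norm_step_le hh n hv
    have h3 := hcE (n + 1) (Nat.lt_succ_of_le hn) le_rfl
    push_cast
    nlinarith [mul_le_mul_of_nonneg_left h3 hh.le]

theorem IsImplicitEuler.norm_sub_antitone {N : ℕ} {E : EuclideanSpace ℝ (Fin N) → ℝ≥0∞} {h : ℝ}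
    (hh : 0 < h) {x : ℕ → EuclideanSpace ℝ (Fin N)} (hx : IsImplicitEuler E h x)
    {z : EuclideanSpace ℝ (Fin N)} (hz : E z = 0) : Antitone fun n => ‖x n - z‖ := by
  refine antitone_nat_of_succ_le fun n => ?_
  have h1 := hx.sq_norm_step_le hh n (v := z) (by simp [hz])
  rw [hz, ENNReal.toReal_zero, zero_sub] at h1
  refine le_of_sq_le_sq ?_ (norm_nonneg _)
  nlinarith [mul_nonneg hh.le (ENNReal.toReal_nonneg (a := E (x (n + 1))))]

theorem IsImplicitEuler.norm_sub_le {N : ℕ} {E : EuclideanSpace ℝ (Fin N) → ℝ≥0∞} {h : ℝ}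
    (hh : 0 < h) {x : ℕ → EuclideanSpace ℝ (Fin N)} (hx : IsImplicitEuler E h x) {C : ℝ}
    (hC : ∀ n, ∀ w ∈ subdifferential E (x n), ‖w‖ ≤ C) {k n : ℕ} (hkn : k ≤ n) :
    ‖x n - x k‖ ≤ C * (h * n - h * k) := by
  induction n, hkn using Nat.le_induction with
  | base => simp
  | succ n hn ih =>
    have h1 := hC (n + 1) _ (hx n)
    rw [norm_smul, norm_inv, Real.norm_of_nonneg hh.le, inv_mul_le_iff₀ hh, norm_sub_rev] at h1
    have h2 := norm_sub_le_norm_sub_add_norm_sub (x (n + 1)) (x n) (x k)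
    push_cast
    linarith

/-! ### Existence of solutions -/

theorem mul_floor_sub_mul_floor_le {h : ℝ} (hh : 0 < h) {s t : ℝ} (hst : s ≤ t) :
    h * ⌊t / h⌋₊ - h * ⌊s / h⌋₊ ≤ t - s + h := by
  have hs := Nat.sub_one_lt_floor (s / h)
  have hs' : s - h ≤ h * ⌊s / h⌋₊ := by
    have := mul_le_mul_of_nonneg_left hs.le hh.le
    rwa [mul_sub, mul_div_cancel₀ _ hh.ne', mul_one] at this
  rcases le_total 0 t with ht | ht
  · have h2 := mul_le_mul_of_nonneg_left (Nat.floor_le (div_nonneg ht hh.le)) hh.le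
    rw [mul_div_cancel₀ _ hh.ne'] at h2
    linarith
  · rw [Nat.floor_of_nonpos (div_nonpos_of_nonpos_of_nonneg ht hh.le)]
    have : 0 ≤ h * (⌊s / h⌋₊ : ℝ) := by positivity
    push_cast
    linarith

theorem tendsto_mul_floor {l : Filter ℕ} {h : ℕ → ℝ} (hh : ∀ m, 0 < h m)
    (hl : Tendsto h l (𝓝 0)) {s : ℝ} (hs : 0 ≤ s) :
    Tendsto (fun m => h m * (⌊s / h m⌋₊ : ℝ)) l (𝓝 s) := by
  have h1 : Tendsto (fun m => s - h m) l (𝓝 s) := by simpa using hl.const_sub s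
  refine tendsto_of_tendsto_of_tendsto_of_le_of_le h1 tendsto_const_nhds (fun m => ?_) fun m => ?_
  · have := mul_le_mul_of_nonneg_left (Nat.sub_one_lt_floor (s / h m)).le (hh m).le
    rwa [mul_sub, mul_div_cancel₀ _ (hh m).ne', mul_one] at this
  · have := mul_le_mul_of_nonneg_left (Nat.floor_le (div_nonneg hs (hh m).le)) (hh m).le
    rwa [mul_div_cancel₀ _ (hh m).ne'] at this

/-- Lower semicontinuity phrased for the real-valued functional on its effective domain. -/
theorem eventually_le_toReal {N : ℕ} {E : EuclideanSpace ℝ (Fin N) → ℝ≥0∞}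
    (hl : LowerSemicontinuous E) {x : EuclideanSpace ℝ (Fin N)} {c : ℝ}
    (hc : ENNReal.ofReal c < E x ∨ c < 0) :
    ∀ᶠ y in 𝓝 x, E y ≠ ∞ → c ≤ (E y).toReal := by
  rcases hc with hc | hc
  · filter_upwards [hl x _ hc] with y hy hyt
    exact (ENNReal.ofReal_le_iff_le_toReal hyt).1 hy.le
  · exact .of_forall fun y _ => hc.le.trans ENNReal.toReal_nonneg

/-- The limit of the implicit Euler scheme. It is a Lipschitz curve along which the distance to
each zero of `E` decreases and which satisfies a local form of the evolution variational
inequality `d/dt ‖u - v‖² / 2 ≤ E v - E u`. The limit is taken along an ultrafilter, so that no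
subsequence has to be extracted. -/
theorem exists_limit_implicitEuler {N : ℕ} {E : EuclideanSpace ℝ (Fin N) → ℝ≥0∞}
    (hc : ConvexOn ℝ≥0 Set.univ E) (hl : LowerSemicontinuous E) (h0 : E 0 = 0)
    (hbdd : HasBoundedGenerator E) (u₀ : EuclideanSpace ℝ (Fin N)) :
    ∃ u : ℝ → EuclideanSpace ℝ (Fin N), u 0 = u₀ ∧ (∃ K, LipschitzWith K u) ∧
      (∀ s, 0 < s → E (u s) ≠ ∞) ∧ (∀ z, E z = 0 → Antitone fun s => ‖u s - z‖) ∧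
      ∀ s c, 0 ≤ s → (∀ᶠ y in 𝓝 (u s), E y ≠ ∞ → c ≤ (E y).toReal) →
        ∀ v, E v ≠ ∞ → ∀ᶠ b in 𝓝[>] s,
          ‖u b - v‖ ^ 2 ≤ ‖u s - v‖ ^ 2 + 2 * (b - s) * ((E v).toReal - c) := by
  set l : Ultrafilter ℕ := hyperfilter ℕ
  have hlt : (l : Filter ℕ) ≤ atTop := Nat.hyperfilter_le_atTop
  set h : ℕ → ℝ := fun m => 1 / ((m : ℝ) + 1)
  have hh : ∀ m, 0 < h m := fun m => Nat.one_div_pos_of_nat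
  have hlim : Tendsto h l (𝓝 0) := tendsto_one_div_add_atTop_nhds_zero_nat.mono_left hlt
  choose x hx0 hx using fun m => exists_isImplicitEuler hc hl h0 (hh m) u₀
  have hxr : ∀ m n, ‖x m n‖ ≤ ‖u₀‖ := fun m n => by
    simpa [hx0] using (hx m).norm_sub_antitone (hh m) h0 (Nat.zero_le n)
  obtain ⟨C, hC⟩ := hbdd ‖u₀‖
  have hC' : ∀ m n, ∀ w ∈ subdifferential E (x m n), ‖w‖ ≤ C := fun m n w hw => by
    simpa using hC _ (hxr m n) w hw
  have hC0 : 0 ≤ C := (norm_nonneg _).trans (hC' 0 1 _ (hx 0 0))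
  have hxE : ∀ m n, E (x m (n + 1)) ≤ ENNReal.ofReal (C * ‖u₀‖) := fun m n => by
    have h1 := (hx m n).2 0 (by simp [h0])
    have h2 := hC' m _ _ (hx m n)
    rw [h0, ENNReal.toReal_zero, zero_sub, inner_neg_right] at h1
    have h3 := real_inner_le_norm ((h m)⁻¹ • (x m n - x m (n + 1))) (x m (n + 1))
    have h4 := mul_le_mul h2 (hxr m (n + 1)) (norm_nonneg _) hC0
    rw [ENNReal.le_ofReal_iff_toReal_le (hx m n).1 (by positivity)]
    linarith
  have hinc : ∀ m (s t : ℝ), s ≤ t → ⌊s / h m⌋₊ ≤ ⌊t / h m⌋₊ := fun m s t hst =>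
    Nat.floor_mono (div_le_div_of_nonneg_right hst (hh m).le)
  have hU : ∀ s : ℝ, ∃ y, Tendsto (fun m => x m ⌊s / h m⌋₊) l (𝓝 y) := fun s => by
    obtain ⟨y, -, hy⟩ := (isCompact_closedBall (0 : EuclideanSpace ℝ (Fin N)) ‖u₀‖
      ).ultrafilter_le_nhds (l.map fun m => x m ⌊s / h m⌋₊) (by
        rw [Ultrafilter.coe_map]
        exact tendsto_principal.2 (.of_forall fun m => mem_closedBall_zero_iff.2 (hxr m _)))
    exact ⟨y, hy⟩
  choose u hu using hU
  have hLip : ∀ m s t, s ≤ t →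
      ‖x m ⌊t / h m⌋₊ - x m ⌊s / h m⌋₊‖ ≤ C * (t - s + h m) := fun m s t hst =>
    ((hx m).norm_sub_le (hh m) (hC' m) (hinc m s t hst)).trans
      (mul_le_mul_of_nonneg_left (mul_floor_sub_mul_floor_le (hh m) hst) hC0)
  refine ⟨u, ?_, ⟨C.toNNReal, ?_⟩, fun s hs => ?_, fun z hz s t hst => ?_, ?_⟩
  · refine tendsto_nhds_unique (hu 0) ?_
    simp [hx0]
  · have key : ∀ s t, s ≤ t → dist (u t) (u s) ≤ C * (t - s) := fun s t hst => by
      rw [dist_eq_norm]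
      have h1 : Tendsto (fun m => C * (t - s + h m)) l (𝓝 (C * (t - s + 0))) :=
        (hlim.const_add _).const_mul _
      rw [add_zero] at h1
      exact le_of_tendsto_of_tendsto' ((hu t).sub (hu s)).norm h1 fun m => hLip m s t hst
    refine LipschitzWith.of_dist_le_mul fun s t => ?_
    rw [Real.coe_toNNReal _ hC0, Real.dist_eq]
    rcases le_total s t with hst | hst
    · rw [dist_comm, abs_sub_comm, abs_of_nonneg (sub_nonneg.2 hst)]
      exact key s t hst
    · rw [abs_of_nonneg (sub_nonneg.2 hst)]
      exact key t s hst
  · have hcl : IsClosed (E ⁻¹' Set.Iic (ENNReal.ofReal (C * ‖u₀‖))) := hl.isClosed_preimage _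
    have hmem : u s ∈ E ⁻¹' Set.Iic (ENNReal.ofReal (C * ‖u₀‖)) := by
      refine hcl.mem_of_tendsto (hu s) ?_
      filter_upwards [hlim.eventually_lt_const hs] with m hm
      have h1 : ⌊s / h m⌋₊ ≠ 0 := (Nat.floor_pos.2 ((one_le_div (hh m)).2 hm.le)).ne'
      obtain ⟨n, hn⟩ := Nat.exists_eq_succ_of_ne_zero h1
      rw [hn]
      exact hxE m n
    exact ne_top_of_le_ne_top ENNReal.ofReal_ne_top hmem
  · exact le_of_tendsto_of_tendsto' ((hu t).sub_const z).norm ((hu s).sub_const z).norm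
      fun m => (hx m).norm_sub_antitone (hh m) hz (hinc m s t hst)
  · intro s c hs hcE v hv
    obtain ⟨ρ, hρ, hball⟩ := Metric.eventually_nhds_iff.1 hcE
    -- Within time `δ` the scheme moves by less than `ρ / 2`, hence stays in the `ρ`-ball at `u s`.
    set δ : ℝ := ρ / (4 * (C + 1)) with hδ
    have hδ0 : 0 < δ := by positivity
    have hδC : C * (δ + δ) ≤ ρ / 2 := by
      rw [hδ]
      field_simp
      nlinarith
    filter_upwards [Ioo_mem_nhdsGT (lt_add_of_pos_right s hδ0)] with b hb
    have hT : Tendsto (fun m => ‖x m ⌊s / h m⌋₊ - v‖ ^ 2 +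
        2 * (h m * (⌊b / h m⌋₊ : ℝ) - h m * (⌊s / h m⌋₊ : ℝ)) * ((E v).toReal - c)) l
        (𝓝 (‖u s - v‖ ^ 2 + 2 * (b - s) * ((E v).toReal - c))) :=
      (((hu s).sub_const v).norm.pow 2).add
        ((((tendsto_mul_floor hh hlim (hs.trans hb.1.le)).sub
          (tendsto_mul_floor hh hlim hs)).const_mul 2).mul_const _)
    refine le_of_tendsto_of_tendsto (((hu b).sub_const v).norm.pow 2) hT ?_
    filter_upwards [hlim.eventually_lt_const hδ0,
      (hu s).eventually (Metric.ball_mem_nhds _ (half_pos hρ))] with m hm hms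
    refine (hx m).sq_norm_le (hh m) hv (hinc m s b hb.1.le) fun j hj hjb => ?_
    obtain ⟨i, rfl⟩ := Nat.exists_eq_succ_of_ne_zero (Nat.ne_zero_of_lt hj)
    refine hball ?_ (hx m i).1
    have h1 := (hx m).norm_sub_le (hh m) (hC' m) hj.le
    have h2 : h m * ((i.succ : ℕ) : ℝ) ≤ h m * (⌊b / h m⌋₊ : ℝ) :=
      mul_le_mul_of_nonneg_left (Nat.cast_le.2 hjb) (hh m).le
    have h3 := mul_floor_sub_mul_floor_le (hh m) hb.1.le
    have h4 : h m * ((i.succ : ℕ) : ℝ) - h m * (⌊s / h m⌋₊ : ℝ) ≤ δ + δ := by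
      linarith [hb.2]
    have h5 := mul_le_mul_of_nonneg_left h4 hC0
    have h6 := dist_triangle (x m i.succ) (x m ⌊s / h m⌋₊) (u s)
    rw [dist_eq_norm (x m i.succ) (x m ⌊s / h m⌋₊)] at h6
    have h7 : dist (x m ⌊s / h m⌋₊) (u s) < ρ / 2 := hms
    linarith

/-- For every initial value the Cauchy problem has a solution. Its distance to each zero of `E`
decreases, and its norm drops at once if `E` does not vanish at the initial value. -/
theorem exists_isSolution {N : ℕ} {E : EuclideanSpace ℝ (Fin N) → ℝ≥0∞}
    (hc : ConvexOn ℝ≥0 Set.univ E) (hl : LowerSemicontinuous E) (h0 : E 0 = 0)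
    (hbdd : HasBoundedGenerator E) (u₀ : EuclideanSpace ℝ (Fin N)) :
    ∃ u, IsSolution E u₀ u ∧ (∀ z, E z = 0 → Antitone fun s => ‖u s - z‖) ∧
      (E u₀ ≠ 0 → ∀ t, 0 < t → ‖u t‖ < ‖u₀‖) := by
  obtain ⟨u, hu0, ⟨K, hK⟩, hfin, hanti, hevi⟩ := exists_limit_implicitEuler hc hl h0 hbdd u₀
  refine ⟨u, ⟨hu0, hK.continuous.continuousOn, fun a b _ _ =>
    (hK.lipschitzOnWith).absolutelyContinuousOnInterval, ?_⟩, hanti, fun hne t ht => ?_⟩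
  · refine (ae_restrict_iff' measurableSet_Ioi).2 ?_
    filter_upwards [hK.ae_differentiableAt_real] with t hd ht
    refine ⟨deriv u t, hd.hasDerivAt, hfin t ht, fun v hv => ?_⟩
    -- By the variational inequality, `⟪u', u - v⟫ ≤ E v - c` for every `c < E (u t)`.
    have key : ∀ c < (E (u t)).toReal, c + inner ℝ (-deriv u t) (v - u t) ≤ (E v).toReal := by
      intro c hcl
      have hlsc : ∀ᶠ y in 𝓝 (u t), E y ≠ ∞ → c ≤ (E y).toReal := by
        refine eventually_le_toReal hl ?_
        rcases lt_or_ge c 0 with h | h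
        · exact .inr h
        · exact .inl ((ENNReal.ofReal_lt_iff_lt_toReal h (hfin t ht)).2 hcl)
      have hD : HasDerivAt (fun s => ‖u s - v‖ ^ 2) (2 * inner ℝ (u t - v) (deriv u t)) t :=
        (hd.hasDerivAt.sub_const v).norm_sq
      have hslope := (hasDerivAt_iff_tendsto_slope.1 hD).mono_left
        (nhdsWithin_mono t fun b (hb : b ∈ Set.Ioi t) => ne_of_gt hb)
      have hle : 2 * inner ℝ (u t - v) (deriv u t) ≤ 2 * ((E v).toReal - c) := by
        refine le_of_tendsto hslope ?_
        filter_upwards [hevi t c (le_of_lt ht) hlsc v hv, self_mem_nhdsWithin] with b hb htb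
        rw [slope_def_field, div_le_iff₀ (sub_pos.2 htb)]
        linarith
      have hin : inner ℝ (-deriv u t) (v - u t) = inner ℝ (u t - v) (deriv u t) := by
        rw [real_inner_comm, ← neg_sub (u t) v, inner_neg_neg]
      linarith
    have h1 : (E (u t)).toReal ≤ (E v).toReal - inner ℝ (-deriv u t) (v - u t) :=
      le_of_forall_lt_imp_le_of_dense fun c hcl => by linarith [key c hcl]
    linarith
  · obtain ⟨c, hc0, hcE⟩ : ∃ c : ℝ, 0 < c ∧ ENNReal.ofReal c < E (u 0) := by
      rw [hu0]
      obtain ⟨r, hr0, hr⟩ := ENNReal.lt_iff_exists_nnreal_btwn.1 (pos_iff_ne_zero.2 hne)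
      exact ⟨r, by exact_mod_cast hr0, by simpa using hr⟩
    have h1 := hevi 0 c le_rfl (eventually_le_toReal hl (.inl hcE)) 0 (by simp [h0])
    obtain ⟨b, hb, hbt⟩ := (h1.and (Ioo_mem_nhdsGT ht)).exists
    have h2 : ‖u t‖ ≤ ‖u b‖ := by simpa using hanti 0 h0 hbt.2.le
    refine h2.trans_lt (lt_of_pow_lt_pow_left₀ 2 (norm_nonneg _) ?_)
    simp only [sub_zero, h0, ENNReal.toReal_zero, zero_sub, hu0] at hb
    nlinarith [mul_pos hbt.1 hc0]

/-! ### Iteration -/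

/-- Iterates of a continuous map that does not increase the distance to any point of `Z` and
strictly decreases the norm off `Z` converge. A cluster point `y` lies in `Z`, since the norm takes
the same value, the limit of the norms of the iterates, at `y` and at its image; then the distance
to `y` decreases along the iterates and has to tend to zero. -/
theorem exists_tendsto_iterate_of_fejer {X : Type*} [NormedAddCommGroup X] [ProperSpace X]
    {P : X → X} (hP : Continuous P) {Z : Set X}
    (hZ : ∀ z ∈ Z, ∀ x, ‖P x - z‖ ≤ ‖x - z‖) (h0 : (0 : X) ∈ Z)
    (hlt : ∀ x, x ∉ Z → ‖P x‖ < ‖x‖) (f : X) :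
    ∃ y, Tendsto (fun n => P^[n] f) atTop (𝓝 y) := by
  have hanti : ∀ z ∈ Z, Antitone fun n => ‖P^[n] f - z‖ := fun z hz =>
    antitone_nat_of_succ_le fun n => by
      simpa only [Function.iterate_succ_apply'] using hZ z hz _
  have hbd : ∀ n, P^[n] f ∈ Metric.closedBall (0 : X) ‖f‖ := fun n => by
    simpa using hanti 0 h0 (Nat.zero_le n)
  obtain ⟨y, -, φ, hφ, hy⟩ := (isCompact_closedBall (0 : X) ‖f‖).tendsto_subseq hbd
  have hn : Tendsto (fun n => ‖P^[n] f‖) atTop (𝓝 (⨅ n, ‖P^[n] f‖)) :=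
    tendsto_atTop_ciInf (by simpa using hanti 0 h0) ⟨0, by rintro _ ⟨n, rfl⟩; positivity⟩
  have h1 : ‖y‖ = ⨅ n, ‖P^[n] f‖ :=
    tendsto_nhds_unique hy.norm (hn.comp hφ.tendsto_atTop)
  have h2 : ‖P y‖ = ⨅ n, ‖P^[n] f‖ := by
    refine tendsto_nhds_unique ((hP.tendsto y).comp hy).norm ?_
    have := hn.comp ((tendsto_add_atTop_nat 1).comp hφ.tendsto_atTop)
    simpa only [Function.comp_def, Function.iterate_succ_apply'] using this
  have hyZ : y ∈ Z := by
    by_contra hyZ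
    exact (hlt y hyZ).ne (h2.trans h1.symm)
  refine ⟨y, tendsto_iff_norm_sub_tendsto_zero.2 ?_⟩
  have h3 : Tendsto (fun n => ‖P^[n] f - y‖) atTop (𝓝 (⨅ n, ‖P^[n] f - y‖)) :=
    tendsto_atTop_ciInf (hanti y hyZ) ⟨0, by rintro _ ⟨n, rfl⟩; positivity⟩
  rwa [tendsto_nhds_unique (h3.comp hφ.tendsto_atTop)
    (tendsto_iff_norm_sub_tendsto_zero.1 hy)] at h3

theorem continuous_semigroup {N : ℕ} {E : EuclideanSpace ℝ (Fin N) → ℝ≥0∞}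
    (hE : IsDirichletForm E) {t : ℝ} (ht : 0 ≤ t) : Continuous (semigroup E t) := by
  have h1 : Continuous fun u => (WithLp.ofLp (semigroup E t u) : Fin N → ℝ) := by
    refine continuous_iff_continuousAt.2 fun v => tendsto_iff_norm_sub_tendsto_zero.2 ?_
    have h2 : Tendsto (fun u : EuclideanSpace ℝ (Fin N) => supNorm (u - v)) (𝓝 v) (𝓝 0) := by
      have h3 : Continuous fun u : EuclideanSpace ℝ (Fin N) =>
          ‖(WithLp.ofLp (u - v) : Fin N → ℝ)‖ := by fun_prop
      simpa [supNorm] using h3.tendsto v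
    exact squeeze_zero (fun u => norm_nonneg _) (fun u => hE.contractive t ht u v) h2
  exact (PiLp.continuous_toLp 2 _).comp h1

theorem exists_tendsto_iterate_semigroup {N : ℕ} {E : EuclideanSpace ℝ (Fin N) → ℝ≥0∞}
    (hE : IsDirichletForm E) (h0 : E 0 = 0) (hbdd : HasBoundedGenerator E) {t : ℝ} (ht : 0 ≤ t)
    (f : EuclideanSpace ℝ (Fin N)) :
    ∃ y, Tendsto (fun n => (semigroup E t)^[n] f) atTop (𝓝 y) := by
  have hsol := exists_isSolution hE.convex hE.lowerSemicontinuous h0 hbdd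
  rcases ht.eq_or_lt with rfl | ht'
  · have hid : semigroup E 0 = id := by
      funext x
      obtain ⟨u, hu, -⟩ := hsol x
      rw [semigroup_eq hu le_rfl, hu.initial, id]
    exact ⟨f, by simp [hid]⟩
  refine exists_tendsto_iterate_of_fejer (continuous_semigroup hE ht) (Z := {z | E z = 0})
    (fun z hz x => ?_) h0 (fun x hx => ?_) f
  · obtain ⟨u, hu, hanti, -⟩ := hsol x
    rw [semigroup_eq hu ht]
    simpa only [hu.initial] using hanti z hz ht
  · obtain ⟨u, hu, -, hlt⟩ := hsol x
    rw [semigroup_eq hu ht]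
    exact hlt hx t ht'

theorem IsAccumulationPointAtInfinity.eq_of_tendsto {N : ℕ}
    {P : EuclideanSpace ℝ (Fin N) → EuclideanSpace ℝ (Fin N)} {f : EuclideanSpace ℝ (Fin N)}
    {x₀ : Fin N} {g y : EuclideanSpace ℝ (Fin N)} (hg : IsAccumulationPointAtInfinity P f x₀ g)
    (hy : Tendsto (normalizedIterate P f x₀) atTop (𝓝 y)) : y = g := by
  have hs : Continuous fun u : EuclideanSpace ℝ (Fin N) => supNorm (u - g) := by
    unfold supNorm; fun_prop
  have h1 : Tendsto (fun n => supNorm (normalizedIterate P f x₀ n - g)) atTop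
      (𝓝 (supNorm (y - g))) := (hs.tendsto y).comp hy
  have h2 : supNorm (y - g) ≤ 0 := by
    refine le_of_forall_pos_le_add fun ε hε => ?_
    rw [zero_add]
    refine le_of_tendsto_of_frequently h1 (frequently_atTop.2 fun n => ?_)
    obtain ⟨m, hnm, hm⟩ := hg n ε hε
    exact ⟨m, hnm.le, hm.le⟩
  have h3 : (WithLp.ofLp (y - g) : Fin N → ℝ) = 0 := norm_le_zero_iff.1 h2
  exact sub_eq_zero.1 ((WithLp.ofLp_eq_zero 2).1 h3)

theorem tendsto_normalizedIterate {N : ℕ}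
    {P : EuclideanSpace ℝ (Fin N) → EuclideanSpace ℝ (Fin N)} {f : EuclideanSpace ℝ (Fin N)}
    (x₀ : Fin N) {y : EuclideanSpace ℝ (Fin N)} (hy : Tendsto (fun n => P^[n] f) atTop (𝓝 y)) :
    Tendsto (normalizedIterate P f x₀) atTop (𝓝 (y - constVec (y x₀))) := by
  have h : Continuous fun u : EuclideanSpace ℝ (Fin N) => u - constVec (N := N) (u x₀) := by
    unfold constVec; fun_prop
  exact (h.tendsto y).comp hy

end NonlinearDirichlet

theorem mainTheorem12 {N : ℕ} (E : EuclideanSpace ℝ (Fin N) → ℝ≥0∞)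
    (hE : NonlinearDirichlet.IsDirichletForm E)
    (hhom : ∀ (c : ℝ) (u : EuclideanSpace ℝ (Fin N)), E (c • u) = ENNReal.ofReal (c ^ 2) * E u)
    (hconst : ∀ (a : ℝ) (u : EuclideanSpace ℝ (Fin N)),
      E (u + NonlinearDirichlet.constVec a) = E u)
    (hbdd : NonlinearDirichlet.HasBoundedGenerator E)
    (t : ℝ) (ht : 0 ≤ t) (f : EuclideanSpace ℝ (Fin N)) (x₀ : Fin N)
    (g : EuclideanSpace ℝ (Fin N))
    (hg : NonlinearDirichlet.IsAccumulationPointAtInfinity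
      (NonlinearDirichlet.semigroup E t) f x₀ g) :
    Tendsto (NonlinearDirichlet.normalizedIterate (NonlinearDirichlet.semigroup E t) f x₀)
        atTop (𝓝 g) ∧
      ∃ h : EuclideanSpace ℝ (Fin N),
        Tendsto (fun n : ℕ => (NonlinearDirichlet.semigroup E t)^[n] f) atTop (𝓝 h) := by
  have h0 : E 0 = 0 := by simpa using hhom 0 0
  obtain ⟨y, hy⟩ := NonlinearDirichlet.exists_tendsto_iterate_semigroup hE h0 hbdd ht f
  have hn := NonlinearDirichlet.tendsto_normalizedIterate x₀ hy
  rw [hg.eq_of_tendsto hn] at hn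
  exact ⟨hn, y, hy⟩
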